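/- Let $r\ge 2$ and let $\mathcal B\subseteq\{0,\dots,r-1\}^{\mathbb Z_{2\times 2}}$ be a set of admissible $2\times2$ patterns. Let $\Sigma_{n\times k}(\mathcal B)$ be the set of $n\times k$ patterns all of whose $2\times 2$ subpatterns lie in $\mathcal B$, and let $$h(\mathcal B)=\lim_{(n,k)\to\infty}\frac1{nk}\log|\Sigma_{n\times k}(\mathcal B)|$$ be the spatial entropy. Here $\log 0=-\infty$, and $(n,k)\to\infty$ means that both indices tend to infinity. For a nonnegative square matrix $A$, let $|A|$ be the sum of its entries and $\rho(A)$ its largest eigenvalue (its spectral radius). $A$ is irreducible if for all indices $i,j$ there is $k\ge1$ with $(A^k)_{i,j}>0$. For $m\ge1$ let $\mathbf T_m=\mathbf T_m(\mathcal B)$ be the $0$-$1$ matrix indexed by $\{0,\dots,r-1\}^m$ whose $(u,v)$ entry is $1$ if and only if, for every $x\in\mathbb Z/m\mathbb Z$, the $2\times2$ pattern with lower row $u_x,u_{x+1}$ and upper row $v_x,v_{x+1}$ lies in $\mathcal B$. Let $\sigma(u_1u_2\cdots u_m)=u_2\cdots u_mu_1$. For $q\ge1$ and $\gamma_q=\begin{bmatrix}1&q\\0&1\end{bmatrix}$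 let $\mathbf T_{\gamma_q,1}$ be the $0$-$1$ matrix indexed by $\{0,\dots,r-1\}^{q+1}$ whose entry at $(w_0\cdots w_q,\,w'_0\cdots w'_q)$ is $1$ if and only if $w_{i+1}=w'_i$ for $0\le i<q$ and the $2\times 2$ pattern with lower row $w_q,w_0$ and upper row $w'_q,w'_0$ lies in $\mathcal B$. It is the transition matrix of the $\mathcal B$-admissible patterns on $\mathbb Z^2$ that are invariant under translation by $(1,q)$. For nonnegative double sequences $N(m,k)$ and $D(m,k)$, say that $N$ is uniformly dominated by $D$ if there is a positive function $c(m,k)$ with $N(m,k)\le c(m,k)D(m,k)$ for all $m,k\ge1$ and $\lim_{(m,k)\to\infty}\frac1{mk}\log c(m,k)=0$. Suppose that one of the following holds. 1. $\mathbf T_m$ is irreducible for every $m\ge1$, and $|\mathbf T_m^k|$ is uniformly dominated by $\rho(\mathbf T_m)^k$. 2. For every $m\ge1$ there is an index set $\overline{\mathcal I}_m$ such that the principal submatrix $\overline{\mathbf T}_m$ of $\mathbf T_m$ on $\overline{\mathcal I}_m$ is a maximum irreducible submatrix (it is irreducible and $\rho(\overline{\mathbf T}_m)=\rho(\mathbf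 T_m)$) and both $u$ and $\sigma^{-1}(u)$ lie in $\overline{\mathcal I}_m$ for some $u$. Moreover $|\mathbf T_m^k|$ is uniformly dominated by $|\overline{\mathbf T}_m^k|$, and $|\overline{\mathbf T}_m^k|$ is uniformly dominated by $\rho(\mathbf T_m)^k$. Then the limit defining $h(\mathcal B)$ exists and $$h(\mathcal B)=\limsup_{q\to\infty}\log\rho(\mathbf T_{\gamma_q,1}).$$ -/

import Mathlib

open Filter Topology
open scoped ENNReal

namespace SkewEntropy

noncomputable section

/-- A `2 × 2` pattern over the symbols `0, …, r - 1`. For `P : Pattern r`, the symbol in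
column `x` (counted from the left) and row `y` (counted from the bottom) is `P x y`. -/
abbrev Pattern (r : ℕ) : Type := Fin 2 → Fin 2 → Fin r

/-- The `2 × 2` pattern with lower row `ll lr` and upper row `ul ur`. -/
def mkPattern {r : ℕ} (ll lr ul ur : Fin r) : Pattern r := ![![ll, ul], ![lr, ur]]

/-- `Σ_{n×k}(B)`: the `n × k` patterns (`n` columns, `k` rows) all of whose `2 × 2`
subpatterns belong to `B`. -/
def admissible {r : ℕ} (B : Set (Pattern r)) (n k : ℕ) : Set (Fin n → Fin k → Fin r) :=
  {U | ∀ (i j : ℕ) (hi : i + 1 < n) (hj : j + 1 < k),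
    mkPattern
      (U ⟨i, by omega⟩ ⟨j, by omega⟩) (U ⟨i + 1, hi⟩ ⟨j, by omega⟩)
      (U ⟨i, by omega⟩ ⟨j + 1, hj⟩) (U ⟨i + 1, hi⟩ ⟨j + 1, hj⟩) ∈ B}

/-- `(1 / (n k)) log |Σ_{n×k}(B)|`, with `log 0 = -∞`. -/
def entropyRate {r : ℕ} (B : Set (Pattern r)) (p : ℕ × ℕ) : EReal :=
  ENNReal.log ((admissible B p.1 p.2).ncard : ℝ≥0∞) / ((p.1 * p.2 : ℕ) : EReal)

/-- The spatial entropy `h(B)`, as the limsup of `entropyRate B` when both sides of the rectangle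
tend to infinity. -/
def spatialEntropy {r : ℕ} (B : Set (Pattern r)) : EReal :=
  limsup (entropyRate B) atTop

open Classical in
/-- The horizontal periodic transition matrix `T_m(B)`. Its indices are the words of length `m`,
read cyclically (`finRotate m x` is `x + 1` modulo `m`), and the entry at `(u, v)` is `1` exactly
when the `m`-periodic pattern of height `2` with lower row `u` and upper row `v` is admissible. -/
def T {r : ℕ} (B : Set (Pattern r)) (m : ℕ) :
    Matrix (Fin m → Fin r) (Fin m → Fin r) ℝ :=
  Matrix.of fun u v =>
    if ∀ x : Fin m, mkPattern (u x) (u (finRotate m x)) (v x) (v (finRotate m x)) ∈ B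
    then 1 else 0

/-- The shift `σ (u₁ u₂ ⋯ u_m) = (u₂ ⋯ u_m u₁)` on words of length `m`. -/
def shift (r m : ℕ) : Equiv.Perm (Fin m → Fin r) :=
  Equiv.arrowCongr (finRotate m).symm (Equiv.refl (Fin r))

open Classical in
/-- The transition matrix `T_{γ_q,1}(B)`, where `γ_q` is the matrix with rows `(1, q)` and `(0, 1)`.
It describes the patterns `U` on `ℤ²` that are invariant under translation by the first
vector `(1, q)` of `γ_q`. Such a `U` is determined by its column `s j = U (0, j)`,
as `U (i, j) = s (j - i q)`, and its `2 × 2` subpatterns have lower row `s j, s (j - q)` and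
upper row `s (j + 1), s (j + 1 - q)`. The indices are the words
`w = (s (j - q), …, s j)` of length `q + 1`, and the next index is the
word `w' = (s (j + 1 - q), …, s (j + 1))`. -/
def Tskew {r : ℕ} (B : Set (Pattern r)) (q : ℕ) :
    Matrix (Fin (q + 1) → Fin r) (Fin (q + 1) → Fin r) ℝ :=
  Matrix.of fun w w' =>
    if (∀ i : Fin q, w i.succ = w' i.castSucc) ∧
        mkPattern (w (Fin.last q)) (w 0) (w' (Fin.last q)) (w' 0) ∈ B
    then 1 else 0

/-- `ρ(A)`: the largest modulus of a complex eigenvalue of the real matrix `A`. -/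
def rho {n : Type*} [Fintype n] [DecidableEq n] (A : Matrix n n ℝ) : ℝ≥0∞ :=
  spectralRadius ℂ (A.map (fun x : ℝ => (x : ℂ)))

/-- `|A|`: the sum of all entries of `A`. -/
def entrySum {n : Type*} [Fintype n] (A : Matrix n n ℝ) : ℝ :=
  ∑ i, ∑ j, A i j

/-- `N m k ≤ c (m, k) * D m k` for all `m, k ≥ 1`, for a positive function `c` such that
`(1 / (m k)) log c (m, k) → 0` when both `m` and `k` tend to infinity. -/
def UniformlyDominated (N D : ℕ → ℕ → ℝ) : Prop :=
  ∃ c : ℕ → ℕ → ℝ,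
    (∀ m k, 1 ≤ m → 1 ≤ k → 0 < c m k ∧ N m k ≤ c m k * D m k) ∧
    Tendsto (fun p : ℕ × ℕ => Real.log (c p.1 p.2) / ((p.1 : ℝ) * (p.2 : ℝ))) atTop (𝓝 0)

/-- The principal submatrix of `A` with index set `I`. -/
def principal {n : Type*} (A : Matrix n n ℝ) (I : Finset n) : Matrix I I ℝ :=
  A.submatrix Subtype.val Subtype.val

/-- `I` is the index set of a maximum irreducible submatrix of the nonnegative matrix `A`: the
principal submatrix on `I` is irreducible and has the same largest eigenvalue as `A`. -/
def IsMaxIrreducible {n : Type*} [Fintype n] [DecidableEq n]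
    (A : Matrix n n ℝ) (I : Finset n) : Prop :=
  (principal A I).IsIrreducible ∧ rho (principal A I) = rho A

end

end SkewEntropy

/-!
The limit exists by a two-dimensional version of Fekete's lemma (`tendsto_entropyRate`): a large
rectangle is tiled by small ones, up to a negligible part.

All spectral radii are reached through Gelfand's formula `|A ^ k| ^ (1 / k) → ρ(A)`
(`tendsto_entrySum_pow_rpow_one_div`), and the entries of powers of `0`-`1` matrices are counts of
walks (`relMatrix_pow_apply`).

*Upper bound* (`limsup_log_rho_Tskew_le`; it holds for every `B`). A walk of length `n q` for
`T_{γ_q,1}` is a long column. Cut into pieces of height `q + 1`, it fills an admissible rectangle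
with `n + 1` columns and `q + 1` rows, from which it can be recovered. Hence `log ρ(T_{γ_q,1})` is
at most the entropy per site of a strip of height `q + 1`, up to a factor `(q + 1) / q`.

*Lower bound* (`spatialEntropy_le_limsup_log_rho_Tskew`). Let `V_k` be the horizontal transfer
matrix on columns of height `k + 1`. Its spectral radius is at least about `exp ((k + 1) h)`. Some
diagonal entry of `V_k ^ m` grows at this rate along a subsequence of `m`
(`exists_frequently_le_pow_apply_self`). As closed walks of columns are walks of cyclic rows, that
entry is at most `|T_m ^ k|`, which is dominated by `ρ(T_m) ^ k`. So for infinitely many `m`,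
`log ρ(T_m) / m` is close to `h` (`frequently_exp_mul_le_rho_T`). By irreducibility the entry of
`T_m ^ q` at `(u, σ⁻¹ u)` grows like `ρ(T_m) ^ q` along a subsequence of `q`
(`exists_frequently_le_pow_apply`). The patterns that it counts are invariant under both `(m, 0)`
and `(1, q)`. They are closed walks of length `q m` for `T_{γ_q,1}`
(`T_pow_apply_le_trace_Tskew_pow`), so `ρ(T_{γ_q,1}) ^ (q m)` is at least about `ρ(T_m) ^ q`.
-/

namespace SkewEntropy

/-! ### Growth of powers of nonnegative matrices -/

section SpectralRadius

variable {n : Type*} [Fintype n] [DecidableEq n]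

theorem entrySum_pow_nonneg {A : Matrix n n ℝ} (hA : ∀ i j, 0 ≤ A i j) (k : ℕ) :
    0 ≤ entrySum (A ^ k) :=
  Finset.sum_nonneg fun i _ => Finset.sum_nonneg fun j _ => Matrix.pow_apply_nonneg hA k i j

theorem apply_le_entrySum_pow {A : Matrix n n ℝ} (hA : ∀ i j, 0 ≤ A i j) (k : ℕ) (i j : n) :
    (A ^ k) i j ≤ entrySum (A ^ k) :=
  (Finset.single_le_sum (f := fun j => (A ^ k) i j)
    (fun j _ => Matrix.pow_apply_nonneg hA k i j) (Finset.mem_univ j)).trans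
  (Finset.single_le_sum (f := fun i => ∑ j, (A ^ k) i j)
    (fun i _ => Finset.sum_nonneg fun j _ => Matrix.pow_apply_nonneg hA k i j)
    (Finset.mem_univ i))

theorem tendsto_ofReal_mul_rpow_one_div {C : ℝ} (hC : 0 < C) {f : ℕ → ℝ} (hf : ∀ k, 0 ≤ f k)
    {x : ℝ≥0∞} (h : Tendsto (fun k : ℕ => ENNReal.ofReal (f k ^ (1 / (k : ℝ)))) atTop (𝓝 x)) :
    Tendsto (fun k : ℕ => ENNReal.ofReal ((C * f k) ^ (1 / (k : ℝ)))) atTop (𝓝 x) := by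
  have h1 : Tendsto (fun k : ℕ => ENNReal.ofReal (C ^ (1 / (k : ℝ)))) atTop (𝓝 1) := by
    rw [← ENNReal.ofReal_one]
    refine ENNReal.tendsto_ofReal ?_
    have := ((Real.continuous_const_rpow hC.ne').tendsto 0).comp tendsto_one_div_atTop_nhds_zero_nat
    simpa [Function.comp_def] using this
  have h2 := ENNReal.Tendsto.mul h1 (Or.inl one_ne_zero) h (Or.inr ENNReal.one_ne_top)
  rw [one_mul] at h2
  refine h2.congr fun k => ?_
  rw [Real.mul_rpow hC.le (hf k), ENNReal.ofReal_mul (Real.rpow_nonneg hC.le _)]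

theorem tendsto_ofReal_pow_rpow_one_div {C b : ℝ} (hC : 0 < C) (hb : 0 ≤ b) :
    Tendsto (fun k : ℕ => ENNReal.ofReal ((C * b ^ k) ^ (1 / (k : ℝ)))) atTop
      (𝓝 (ENNReal.ofReal b)) := by
  refine tendsto_ofReal_mul_rpow_one_div hC (fun k => pow_nonneg hb k) ?_
  refine tendsto_const_nhds.congr' ?_
  filter_upwards [eventually_gt_atTop 0] with k hk
  rw [one_div, Real.pow_rpow_inv_natCast hb hk.ne']

attribute [local instance] Matrix.linftyOpNormedRing Matrix.linftyOpNormedAlgebra in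
/-- Gelfand's formula, with the sum of all entries in place of a matrix norm. -/
theorem tendsto_entrySum_pow_rpow_one_div {A : Matrix n n ℝ} (hA : ∀ i j, 0 ≤ A i j) :
    Tendsto (fun k : ℕ => ENNReal.ofReal (entrySum (A ^ k) ^ (1 / (k : ℝ)))) atTop
      (𝓝 (rho A)) := by
  have hG := spectrum.pow_norm_pow_one_div_tendsto_nhds_spectralRadius
    (A.map (fun x : ℝ => (x : ℂ)))
  have hpow : ∀ k, (A.map (fun x : ℝ => (x : ℂ))) ^ k = (A ^ k).map (fun x : ℝ => (x : ℂ)) :=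
    fun k => (map_pow (Complex.ofRealHom.mapMatrix (m := n)) A k).symm
  have hrow : ∀ k i, ∑ j, ‖((A ^ k).map (fun x : ℝ => (x : ℂ))) i j‖₊
      = (⟨∑ j, (A ^ k) i j,
        Finset.sum_nonneg fun j _ => Matrix.pow_apply_nonneg hA k i j⟩ : NNReal) := by
    intro k i
    ext
    simp only [NNReal.coe_sum, coe_nnnorm, Matrix.map_apply, Complex.norm_real]
    exact Finset.sum_congr rfl fun j _ => Real.norm_of_nonneg (Matrix.pow_apply_nonneg hA k i j)
  have hle : ∀ k, ‖(A.map (fun x : ℝ => (x : ℂ))) ^ k‖ ≤ entrySum (A ^ k) := by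
    intro k
    rw [hpow, ← coe_nnnorm, Matrix.linfty_opNNNorm_def]
    have : (Finset.univ.sup fun i => ∑ j, ‖((A ^ k).map (fun x : ℝ => (x : ℂ))) i j‖₊)
        ≤ (⟨entrySum (A ^ k), entrySum_pow_nonneg hA k⟩ : NNReal) := by
      refine Finset.sup_le fun i _ => ?_
      rw [hrow]
      exact Finset.single_le_sum (f := fun i => ∑ j, (A ^ k) i j)
        (fun i _ => Finset.sum_nonneg fun j _ => Matrix.pow_apply_nonneg hA k i j)
        (Finset.mem_univ i)
    exact this
  have hge : ∀ k, entrySum (A ^ k) ≤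
      (Fintype.card n + 1 : ℝ) * ‖(A.map (fun x : ℝ => (x : ℂ))) ^ k‖ := by
    intro k
    have : entrySum (A ^ k) ≤
        ∑ _i : n, ‖(A.map (fun x : ℝ => (x : ℂ))) ^ k‖ := by
      refine Finset.sum_le_sum fun i _ => ?_
      rw [hpow, ← coe_nnnorm, Matrix.linfty_opNNNorm_def]
      have := Finset.le_sup (f := fun i => ∑ j, ‖((A ^ k).map (fun x : ℝ => (x : ℂ))) i j‖₊)
        (Finset.mem_univ i)
      rw [hrow] at this
      exact this
    rw [Finset.sum_const, Finset.card_univ, nsmul_eq_mul] at this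
    nlinarith [norm_nonneg ((A.map (fun x : ℝ => (x : ℂ))) ^ k)]
  refine tendsto_of_tendsto_of_tendsto_of_le_of_le hG
    (tendsto_ofReal_mul_rpow_one_div (C := Fintype.card n + 1) (by positivity)
      (fun k => norm_nonneg _) hG) (fun k => ?_) (fun k => ?_)
  · exact ENNReal.ofReal_le_ofReal (Real.rpow_le_rpow (norm_nonneg _) (hle k) (by positivity))
  · exact ENNReal.ofReal_le_ofReal
      (Real.rpow_le_rpow (entrySum_pow_nonneg hA k) (hge k) (by positivity))

theorem rho_le_of_frequently {A : Matrix n n ℝ} (hA : ∀ i j, 0 ≤ A i j) {b C : ℝ} (hb : 0 ≤ b)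
    (hC : 0 < C) (h : ∃ᶠ k in atTop, entrySum (A ^ k) ≤ C * b ^ k) :
    rho A ≤ ENNReal.ofReal b :=
  le_of_tendsto_of_tendsto_of_frequently (tendsto_entrySum_pow_rpow_one_div hA)
    (tendsto_ofReal_pow_rpow_one_div hC hb) <| h.mono fun k hk =>
      ENNReal.ofReal_le_ofReal
        (Real.rpow_le_rpow (entrySum_pow_nonneg hA k) hk (by positivity))

theorem le_rho_of_frequently {A : Matrix n n ℝ} (hA : ∀ i j, 0 ≤ A i j) {b C : ℝ} (hb : 0 ≤ b)
    (hC : 0 < C) (h : ∃ᶠ k in atTop, C * b ^ k ≤ entrySum (A ^ k)) :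
    ENNReal.ofReal b ≤ rho A :=
  le_of_tendsto_of_tendsto_of_frequently (tendsto_ofReal_pow_rpow_one_div hC hb)
    (tendsto_entrySum_pow_rpow_one_div hA) <| h.mono fun k hk =>
      ENNReal.ofReal_le_ofReal
        (Real.rpow_le_rpow (by positivity) hk (by positivity))

attribute [local instance] Matrix.linftyOpNormedRing Matrix.linftyOpNormedAlgebra in
theorem rho_ne_top (A : Matrix n n ℝ) : rho A ≠ ⊤ := by
  refine ne_top_of_le_ne_top ?_ (spectrum.spectralRadius_le_pow_nnnorm_pow_one_div ℂ
    (A.map (fun x : ℝ => (x : ℂ))) 0)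
  simp [ENNReal.mul_eq_top]

theorem pow_mul_apply_self {A : Matrix n n ℝ} (hA : ∀ i j, 0 ≤ A i j) (u : n) (k l : ℕ) :
    (A ^ k) u u ^ l ≤ (A ^ (k * l)) u u := by
  induction l with
  | zero => simp
  | succ l ih =>
    rw [pow_succ, Nat.mul_succ, pow_add, Matrix.mul_apply]
    exact (mul_le_mul_of_nonneg_right ih (Matrix.pow_apply_nonneg hA k u u)).trans
      (Finset.single_le_sum (f := fun j => (A ^ (k * l)) u j * (A ^ k) j u)
        (fun j _ => mul_nonneg (Matrix.pow_apply_nonneg hA _ u j)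
          (Matrix.pow_apply_nonneg hA _ j u)) (Finset.mem_univ u))

/-- Closed walks of length `k` can be repeated, so they bound the spectral radius from below. -/
theorem le_rho_of_pow_le_apply_self {A : Matrix n n ℝ} (hA : ∀ i j, 0 ≤ A i j) {u : n} {b : ℝ}
    (hb : 0 ≤ b) {k : ℕ} (hk : 0 < k) (h : b ^ k ≤ (A ^ k) u u) : ENNReal.ofReal b ≤ rho A := by
  refine le_rho_of_frequently hA hb one_pos ?_
  rw [frequently_atTop]
  refine fun N => ⟨k * N, Nat.le_mul_of_pos_left N hk, ?_⟩
  rw [one_mul, pow_mul]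
  exact (pow_le_pow_left₀ (pow_nonneg hb k) h N).trans
    ((pow_mul_apply_self hA u k N).trans (apply_le_entrySum_pow hA _ u u))

theorem mul_mul_le_pow_apply {A : Matrix n n ℝ} (hA : ∀ i j, 0 ≤ A i j) (u i j v : n)
    (d k e : ℕ) : (A ^ d) u i * (A ^ k) i j * (A ^ e) j v ≤ (A ^ (d + k + e)) u v := by
  rw [pow_add, pow_add, Matrix.mul_apply]
  refine le_trans ?_ (Finset.single_le_sum
    (f := fun l => (A ^ d * A ^ k) u l * (A ^ e) l v) (fun l _ => mul_nonneg ?_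
      (Matrix.pow_apply_nonneg hA _ _ _)) (Finset.mem_univ j))
  · refine mul_le_mul_of_nonneg_right ?_ (Matrix.pow_apply_nonneg hA _ _ _)
    rw [Matrix.mul_apply]
    exact Finset.single_le_sum (f := fun l => (A ^ d) u l * (A ^ k) l j) (fun l _ => mul_nonneg
      (Matrix.pow_apply_nonneg hA _ _ _) (Matrix.pow_apply_nonneg hA _ _ _)) (Finset.mem_univ i)
  · rw [← pow_add]
    exact Matrix.pow_apply_nonneg hA _ _ _

/-- For an irreducible matrix every entry of the powers grows, along a subsequence, at any rate
below the spectral radius: a large entry of `A ^ k` is moved to the position `(u, v)` by walks of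
bounded length. -/
theorem exists_frequently_le_pow_apply {A : Matrix n n ℝ} (hA : A.IsIrreducible) (u v : n)
    {a : ℝ} (ha : 0 < a) (h : ENNReal.ofReal a < rho A) :
    ∃ C > 0, ∃ᶠ k in atTop, C * a ^ k ≤ (A ^ k) u v := by
  have hpos := (Matrix.isIrreducible_iff_exists_pow_pos hA.nonneg).1 hA
  choose d _ hd using hpos
  have hn := hA.nonneg
  set c : ℝ := Fintype.card n * Fintype.card n with hc
  have hcard : 0 < Fintype.card n := Fintype.card_pos_iff.2 ⟨u⟩
  have hcpos : 0 < c := by positivity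
  -- otherwise `entrySum (A ^ k) ≤ a ^ k` infinitely often, and `rho A ≤ a`
  have hev : ∀ᶠ k in atTop, a ^ k < entrySum (A ^ k) := by
    by_contra hcon
    rw [not_eventually] at hcon
    refine (rho_le_of_frequently hn ha.le one_pos (hcon.mono fun k hk => ?_)).not_gt h
    rw [one_mul]
    exact not_lt.1 hk
  have hij : ∀ᶠ k in atTop, ∃ p : n × n, a ^ k / c < (A ^ k) p.1 p.2 := by
    filter_upwards [hev] with k hk
    by_contra! hcon
    refine absurd hk (not_lt.2 ?_)
    calc entrySum (A ^ k) ≤ ∑ _i : n, ∑ _j : n, a ^ k / c :=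
          Finset.sum_le_sum fun i _ => Finset.sum_le_sum fun j _ => hcon (i, j)
      _ = a ^ k := by
          simp only [Finset.sum_const, Finset.card_univ, nsmul_eq_mul]
          rw [← mul_assoc, ← hc, mul_div_cancel₀ _ hcpos.ne']
  obtain ⟨p, hp⟩ := frequently_exists.1 hij.frequently
  set δ := (A ^ d u p.1) u p.1 * (A ^ d p.2 v) p.2 v with hδ
  have hδpos : 0 < δ := mul_pos (hd _ _) (hd _ _)
  refine ⟨δ / c / a ^ (d u p.1 + d p.2 v), by positivity, ?_⟩
  rw [frequently_atTop] at hp ⊢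
  intro N
  obtain ⟨k, hk, hkp⟩ := hp N
  refine ⟨d u p.1 + k + d p.2 v, by omega, ?_⟩
  refine le_trans ?_ (mul_mul_le_pow_apply hn u p.1 p.2 v _ k _)
  calc δ / c / a ^ (d u p.1 + d p.2 v) * a ^ (d u p.1 + k + d p.2 v)
      = δ * (a ^ k / c) := by
        rw [show d u p.1 + k + d p.2 v = d u p.1 + d p.2 v + k by ring, pow_add a _ k]
        field_simp
    _ ≤ δ * (A ^ k) p.1 p.2 := mul_le_mul_of_nonneg_left hkp.le hδpos.le
    _ = _ := by rw [hδ]; ring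

theorem submatrix_pow_apply_le {m : Type*} [Fintype m] [DecidableEq m] {A : Matrix n n ℝ}
    (hA : ∀ i j, 0 ≤ A i j) {f : m → n} (hf : f.Injective) (k : ℕ) (i j : m) :
    ((A.submatrix f f) ^ k) i j ≤ (A ^ k) (f i) (f j) := by
  induction k generalizing j with
  | zero => simp [Matrix.one_apply, hf.eq_iff]
  | succ k ih =>
    rw [pow_succ, pow_succ, Matrix.mul_apply, Matrix.mul_apply]
    calc ∑ l, ((A.submatrix f f) ^ k) i l * A (f l) (f j)
        ≤ ∑ l, (A ^ k) (f i) (f l) * A (f l) (f j) :=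
          Finset.sum_le_sum fun l _ => mul_le_mul_of_nonneg_right (ih l) (hA _ _)
      _ = ∑ l ∈ Finset.univ.map ⟨f, hf⟩, (A ^ k) (f i) l * A l (f j) := by
          rw [Finset.sum_map]; rfl
      _ ≤ _ := Finset.sum_le_sum_of_subset_of_nonneg (Finset.subset_univ _)
          fun l _ _ => mul_nonneg (Matrix.pow_apply_nonneg hA _ _ _) (hA _ _)

/-- The spectrum of a block triangular matrix is contained in the union of those of its diagonal
blocks, as the determinant of `z - A` is a product. -/
theorem rho_le_max_of_blockTriangular (A : Matrix n n ℝ) (p : n → Prop) [DecidablePred p]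
    (h : ∀ i, ¬ p i → ∀ j, p j → A i j = 0) :
    rho A ≤ max (rho (A.submatrix (Subtype.val : {i // p i} → n) Subtype.val))
      (rho (A.submatrix (Subtype.val : {i // ¬ p i} → n) Subtype.val)) := by
  have key : ∀ (m : Type _) [Fintype m] [DecidableEq m] (M : Matrix m m ℂ) (z : ℂ),
      z ∈ spectrum ℂ M ↔ (algebraMap ℂ (Matrix m m ℂ) z - M).det = 0 := by
    intro m _ _ M z
    rw [spectrum.mem_iff, Matrix.isUnit_iff_isUnit_det, isUnit_iff_ne_zero, not_not]
  refine iSup₂_le fun z hz => ?_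
  rw [key, Matrix.twoBlockTriangular_det _ p, mul_eq_zero] at hz
  · refine le_max_iff.2 (hz.imp (fun hz => ?_) (fun hz => ?_))
    all_goals
      refine le_iSup₂_of_le z ((key _ _ _).2 ?_) le_rfl
      rw [← hz]
      congr 1
      ext i j
      simp [Matrix.toSquareBlockProp, Matrix.algebraMap_matrix_apply, Subtype.ext_iff]
  · intro i hi j hj
    have : i ≠ j := fun e => hi (e ▸ hj)
    simp [Matrix.algebraMap_matrix_apply, this, h i hi j hj]

/-- Every nonnegative matrix has a diagonal position whose entries in the powers grow, along a
subsequence, at any given rate below the spectral radius. A reducible matrix is block triangular,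
so one of its two diagonal blocks has the same spectral radius, and induction leads to an
irreducible block. -/
theorem exists_frequently_le_pow_apply_self {n : Type*} [Fintype n] [DecidableEq n]
    {A : Matrix n n ℝ} (hA : ∀ i j, 0 ≤ A i j) {a : ℝ} (ha : 0 < a)
    (h : ENNReal.ofReal a < rho A) :
    ∃ u, ∃ C > 0, ∃ᶠ k in atTop, C * a ^ k ≤ (A ^ k) u u := by
  classical
  induction hN : Fintype.card n using Nat.strong_induction_on generalizing n with
  | _ N ih =>
  have hne : Nonempty n := by
    by_contra hcon
    rw [not_nonempty_iff] at hcon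
    have : rho A = 0 := by
      rw [Subsingleton.elim A 0]
      simp [rho]
    simp [this] at h
  by_cases hirr : A.IsIrreducible
  · exact ⟨hne.some, exists_frequently_le_pow_apply hirr _ _ ha h⟩
  -- a proper nonempty set of indices that no positive entry leaves allows the induction step
  have hblock : ∀ S : n → Prop, (∃ i, S i) → (∃ i, ¬ S i) →
      (∀ i, S i → ∀ j, ¬ S j → A i j = 0) →
      ∃ u, ∃ C > 0, ∃ᶠ k in atTop, C * a ^ k ≤ (A ^ k) u u := by
    intro S hS hS' hclosed
    have hmax := rho_le_max_of_blockTriangular A (fun i => ¬ S i)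
      (fun i hi j hj => hclosed i (not_not.1 hi) j hj)
    have hsub : ∀ (q : n → Prop) [DecidablePred q], (∃ i, ¬ q i) → ENNReal.ofReal a <
        rho (A.submatrix (Subtype.val : {i // q i} → n) Subtype.val) →
        ∃ u, ∃ C > 0, ∃ᶠ k in atTop, C * a ^ k ≤ (A ^ k) u u := by
      rintro q _ ⟨i, hi⟩ hq
      obtain ⟨u, C, hC, hu⟩ := ih _ (hN ▸ Fintype.card_subtype_lt (x := i) hi)
        (fun i j => hA _ _) hq rfl
      exact ⟨u, C, hC, hu.mono fun k hk =>
        hk.trans (submatrix_pow_apply_le hA Subtype.val_injective k u u)⟩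
    rcases lt_max_iff.1 (h.trans_le hmax) with hlt | hlt
    · exact hsub _ (hS.imp fun i hi => not_not.2 hi) hlt
    · exact hsub _ (hS'.imp fun i hi => not_not.2 hi) hlt
  rw [Matrix.isIrreducible_iff_exists_pow_pos hA] at hirr
  push Not at hirr
  obtain ⟨i, v, hiv⟩ := hirr
  by_cases hex : ∃ j, ∃ k > 0, 0 < (A ^ k) i j
  · refine hblock (fun j => ∃ k > 0, 0 < (A ^ k) i j) hex
      ⟨v, fun ⟨k, hk, hlt⟩ => (hiv k hk).not_gt hlt⟩ ?_
    rintro j ⟨k, hk, hj⟩ l hl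
    by_contra hjl
    refine hl ⟨k + 1, k.succ_pos, ?_⟩
    rw [pow_succ, Matrix.mul_apply]
    exact (mul_pos hj (lt_of_le_of_ne (hA j l) (Ne.symm hjl))).trans_le
      (Finset.single_le_sum (f := fun j => (A ^ k) i j * A j l) (fun j _ => mul_nonneg
        (Matrix.pow_apply_nonneg hA _ _ _) (hA _ _)) (Finset.mem_univ j))
  · have hrow : ∀ j, A i j = 0 := by
      intro j
      by_contra hj
      exact hex ⟨j, 1, one_pos, by rw [pow_one]; exact lt_of_le_of_ne (hA i j) (Ne.symm hj)⟩
    by_cases hall : ∃ j, j ≠ i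
    · refine hblock (fun j => j = i) ⟨i, rfl⟩ hall ?_
      rintro _ rfl j _
      exact hrow j
    · push Not at hall
      have h0 : A = 0 := by
        ext j l
        rw [hall j]
        exact hrow l
      simp [h0, rho] at h

end SpectralRadius

/-! ### Walks and powers of adjacency matrices -/

section Walks

variable {α : Type*}

/-- The walks with `k` steps of the directed graph on `α` with edge relation `R`, given by their
`k + 1` vertices. -/
def walks (R : α → α → Prop) (k : ℕ) : Set (Fin (k + 1) → α) :=
  {f | ∀ i : Fin k, R (f i.castSucc) (f i.succ)}

open Classical in
/-- The `0`-`1` adjacency matrix of a relation. -/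
noncomputable def relMatrix (R : α → α → Prop) : Matrix α α ℝ :=
  Matrix.of fun u v => if R u v then 1 else 0

theorem relMatrix_nonneg (R : α → α → Prop) (u v : α) : 0 ≤ relMatrix R u v := by
  unfold relMatrix
  rw [Matrix.of_apply]
  split_ifs <;> norm_num

theorem snoc_mem_walks (R : α → α → Prop) (k : ℕ) (f : Fin (k + 1) → α) (x : α) :
    (Fin.snoc f x : Fin (k + 2) → α) ∈ walks R (k + 1) ↔
      f ∈ walks R k ∧ R (f (Fin.last k)) x := by
  simp only [walks, Set.mem_ofPred_eq]
  rw [Fin.forall_fin_succ']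
  have h1 : ∀ i : Fin (k + 1), (Fin.snoc f x : Fin (k + 2) → α) i.castSucc = f i :=
    fun i => Fin.snoc_castSucc (α := fun _ => α) x f i
  have h2 : (Fin.snoc f x : Fin (k + 2) → α) (Fin.last (k + 1)) = x :=
    Fin.snoc_last (α := fun _ => α) x f
  simp only [h1, Fin.succ_last, Fin.succ_castSucc, h2]

variable [Fintype α] [DecidableEq α]

open Classical in
theorem relMatrix_pow_apply_eq_sum (R : α → α → Prop) (k : ℕ) (u v : α) :
    (relMatrix R ^ k) u v = ∑ f : Fin (k + 1) → α,
      if f ∈ walks R k ∧ f 0 = u ∧ f (Fin.last k) = v then (1 : ℝ) else 0 := by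
  induction k generalizing v with
  | zero =>
    rw [← (Equiv.funUnique (Fin 1) α).symm.sum_comp]
    by_cases huv : u = v
    · subst huv
      simp [walks]
    · have : ∀ x : α, ¬ (x = u ∧ x = v) := fun x hx => huv (hx.1.symm.trans hx.2)
      simp [walks, huv, this]
  | succ k ih =>
    rw [pow_succ, Matrix.mul_apply]
    simp only [ih, Finset.sum_mul]
    rw [Finset.sum_comm, ← (Fin.snocEquiv fun _ : Fin (k + 2) => α).sum_comp,
      Fintype.sum_prod_type_right]
    refine Finset.sum_congr rfl fun f _ => ?_
    have h0 : ∀ x : α, (Fin.snoc f x : Fin (k + 2) → α) 0 = f 0 := fun x =>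
      Fin.snoc_castSucc (α := fun _ => α) x f 0
    have h2 : ∀ x : α, (Fin.snoc f x : Fin (k + 2) → α) (Fin.last (k + 1)) = x := fun x =>
      Fin.snoc_last (α := fun _ => α) x f
    rw [Finset.sum_eq_single (f (Fin.last k)), Finset.sum_eq_single v]
    · change _ = if (Fin.snoc f v : Fin (k + 2) → α) ∈ walks R (k + 1) ∧
        (Fin.snoc f v : Fin (k + 2) → α) 0 = u ∧
        (Fin.snoc f v : Fin (k + 2) → α) (Fin.last (k + 1)) = v then (1 : ℝ) else 0
      rw [snoc_mem_walks, h0, h2]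
      by_cases h3 : R (f (Fin.last k)) v <;> simp [relMatrix, h3]
    · intro x _ hx
      change (if (Fin.snoc f x : Fin (k + 2) → α) ∈ walks R (k + 1) ∧
        (Fin.snoc f x : Fin (k + 2) → α) 0 = u ∧
        (Fin.snoc f x : Fin (k + 2) → α) (Fin.last (k + 1)) = v then (1 : ℝ) else 0) = 0
      rw [h2]
      simp [hx]
    · simp
    · intro x _ hx
      simp [Ne.symm hx]
    · simp

theorem relMatrix_pow_apply (R : α → α → Prop) (k : ℕ) (u v : α) :
    (relMatrix R ^ k) u v = {f ∈ walks R k | f 0 = u ∧ f (Fin.last k) = v}.ncard := by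
  classical
  rw [relMatrix_pow_apply_eq_sum, Finset.sum_boole, Set.ncard_eq_toFinset_card']
  congr 2
  ext f
  simp only [Finset.mem_filter, Finset.mem_univ, true_and, Set.mem_toFinset, Set.mem_ofPred_eq]

theorem entrySum_relMatrix_pow (R : α → α → Prop) (k : ℕ) :
    entrySum (relMatrix R ^ k) = (walks R k).ncard := by
  classical
  have : ∀ f : Fin (k + 1) → α, ∑ u, ∑ v,
      (if f ∈ walks R k ∧ f 0 = u ∧ f (Fin.last k) = v then (1 : ℝ) else 0) =
      if f ∈ walks R k then 1 else 0 := by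
    intro f
    by_cases hf : f ∈ walks R k
    · simp [hf, ite_and]
    · simp [hf]
  unfold entrySum
  simp only [relMatrix_pow_apply_eq_sum]
  rw [Finset.sum_congr rfl fun u _ => Finset.sum_comm, Finset.sum_comm,
    Finset.sum_congr rfl fun f _ => this f, Finset.sum_boole, Set.ncard_eq_toFinset_card']
  congr 2
  ext f
  simp

theorem trace_relMatrix_pow (R : α → α → Prop) (k : ℕ) :
    (relMatrix R ^ k).trace = {f ∈ walks R k | f 0 = f (Fin.last k)}.ncard := by
  classical
  have : ∀ f : Fin (k + 1) → α, ∑ u,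
      (if f ∈ walks R k ∧ f 0 = u ∧ f (Fin.last k) = u then (1 : ℝ) else 0) =
      if f ∈ walks R k ∧ f 0 = f (Fin.last k) then 1 else 0 := by
    intro f
    by_cases hf : f ∈ walks R k
    · simp [hf, ite_and, eq_comm]
    · simp [hf]
  unfold Matrix.trace
  simp only [Matrix.diag_apply, relMatrix_pow_apply_eq_sum]
  rw [Finset.sum_comm, Finset.sum_congr rfl fun f _ => this f, Finset.sum_boole,
    Set.ncard_eq_toFinset_card']
  congr 2
  ext f
  simp

end Walks

/-! ### Patterns as walks -/

section Transfer

variable {r : ℕ} (B : Set (Pattern r))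

/-- Two columns of height `k + 1` may stand side by side, `c` on the left of `d`. -/
def colRel (k : ℕ) (c d : Fin (k + 1) → Fin r) : Prop :=
  ∀ j : Fin k, mkPattern (c j.castSucc) (d j.castSucc) (c j.succ) (d j.succ) ∈ B

/-- The cyclic row `v` of length `m` may stand on top of the cyclic row `u`. -/
def rowRel (m : ℕ) (u v : Fin m → Fin r) : Prop :=
  ∀ x : Fin m, mkPattern (u x) (u (finRotate m x)) (v x) (v (finRotate m x)) ∈ B

/-- The window `w'` may follow the window `w` in a column of a pattern that is invariant under
translation by `(1, q)`. -/
def skewRel (q : ℕ) (w w' : Fin (q + 1) → Fin r) : Prop :=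
  (∀ i : Fin q, w i.succ = w' i.castSucc) ∧
    mkPattern (w (Fin.last q)) (w 0) (w' (Fin.last q)) (w' 0) ∈ B

theorem T_eq_relMatrix (m : ℕ) : T B m = relMatrix (rowRel B m) := by
  ext u v
  simp only [T, relMatrix, rowRel, Matrix.of_apply]
  congr

theorem Tskew_eq_relMatrix (q : ℕ) : Tskew B q = relMatrix (skewRel B q) := by
  ext u v
  simp only [Tskew, relMatrix, skewRel, Matrix.of_apply]
  congr

theorem admissible_succ_succ (n k : ℕ) :
    admissible B (n + 1) (k + 1) = walks (colRel B k) n := by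
  ext U
  constructor
  · intro h i j
    exact h i j (by omega) (by omega)
  · intro h i j hi hj
    exact h ⟨i, by omega⟩ ⟨j, by omega⟩

/-- A closed walk of columns is, read by rows, a walk of cyclic rows. -/
theorem relMatrix_colRel_pow_apply_self_le (k m : ℕ) (hm : 1 ≤ m) (c : Fin (k + 1) → Fin r) :
    (relMatrix (colRel B k) ^ m) c c ≤ entrySum (T B m ^ k) := by
  obtain ⟨m, rfl⟩ : ∃ m', m = m' + 1 := ⟨m - 1, by omega⟩
  rw [relMatrix_pow_apply, T_eq_relMatrix, entrySum_relMatrix_pow, Nat.cast_le]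
  refine Set.ncard_le_ncard_of_injOn (fun f j x => f x.castSucc j) ?_ ?_ (Set.toFinite _)
  · rintro f ⟨hf, h0, hl⟩ j x
    have hrot : f (finRotate (m + 1) x).castSucc = f x.succ := by
      induction x using Fin.lastCases with
      | last =>
        rw [finRotate_last, Fin.succ_last]
        exact h0.trans hl.symm
      | cast x =>
        congr 1
        rw [finRotate_apply]
        ext
        simp
    simp only [hrot]
    exact hf x j
  · rintro f ⟨-, hf0, hfl⟩ g ⟨-, hg0, hgl⟩ hfg
    ext x j
    induction x using Fin.lastCases with
    | last => rw [hfl, hgl]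
    | cast x => exact congrArg Fin.val (congrFun (congrFun hfg j) x)

/-- A walk of windows of length `n q` fills a rectangle with `n + 1` columns and `q + 1` rows: the
`i`-th column is the window at time `(n - i) q`. -/
theorem entrySum_Tskew_pow_le (n q : ℕ) (hq : 1 ≤ q) :
    entrySum (Tskew B q ^ (n * q)) ≤ (admissible B (n + 1) (q + 1)).ncard := by
  rw [Tskew_eq_relMatrix, entrySum_relMatrix_pow, Nat.cast_le]
  -- the windows as functions of two natural numbers
  let F (f : Fin (n * q + 1) → Fin (q + 1) → Fin r) (t j : ℕ) : Fin r :=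
    f (Fin.ofNat _ t) (Fin.ofNat _ j)
  have hF : ∀ f t j (ht : t < n * q + 1) (hj : j < q + 1), F f t j = f ⟨t, ht⟩ ⟨j, hj⟩ := by
    intro f t j ht hj
    simp [F, Fin.ofNat, Nat.mod_eq_of_lt ht, Nat.mod_eq_of_lt hj]
  -- a window at time `t + d` is the window at time `t`, moved up by `d` rows
  have hshift : ∀ f ∈ walks (skewRel B q) (n * q), ∀ d t j, t + d ≤ n * q → j + d ≤ q →
      F f (t + d) j = F f t (j + d) := by
    intro f hf d
    induction d with
    | zero => intros; rfl
    | succ d ih =>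
      intro t j ht hj
      have hstep := (hf ⟨t + d, by omega⟩).1 ⟨j, by omega⟩
      rw [← add_assoc, hF f (t + d + 1) j (by omega) (by omega), add_comm d 1, ← add_assoc,
        ← ih t (j + 1) (by omega) (by omega), hF _ _ _ (by omega) (by omega)]
      exact hstep.symm
  have hpat : ∀ f ∈ walks (skewRel B q) (n * q), ∀ t, t < n * q →
      mkPattern (F f t q) (F f t 0) (F f (t + 1) q) (F f (t + 1) 0) ∈ B := by
    intro f hf t ht
    rw [hF _ _ _ (by omega) (by omega), hF _ _ _ (by omega) (by omega),
      hF _ _ _ (by omega) (by omega), hF _ _ _ (by omega) (by omega)]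
    exact (hf ⟨t, ht⟩).2
  refine Set.ncard_le_ncard_of_injOn (fun f i j => F f ((n - i) * q) j) ?_ ?_ (Set.toFinite _)
  · intro f hf i j hi hj
    obtain ⟨a, rfl⟩ : ∃ a, n = a + 1 + i := ⟨n - i - 1, by omega⟩
    have ha : a * q + q ≤ (a + 1 + i) * q := by nlinarith
    have h1 := hpat f hf (a * q + j) (by omega)
    have e1 : F f (a * q + j) q = F f ((a + 1) * q) j := by
      have := hshift f hf (q - j) (a * q + j) j (by omega) (by omega)
      rw [show j + (q - j) = q by omega] at this
      rw [← this]
      congr 1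
      rw [add_mul, one_mul]; omega
    have e2 : F f (a * q + j + 1) q = F f ((a + 1) * q) (j + 1) := by
      have := hshift f hf (q - j - 1) (a * q + j + 1) (j + 1) (by omega) (by omega)
      rw [show j + 1 + (q - j - 1) = q by omega] at this
      rw [← this]
      congr 1
      rw [add_mul, one_mul]; omega
    have e3 : F f (a * q + j) 0 = F f (a * q) j := by
      rw [hshift f hf j (a * q) 0 (by omega) (by omega), zero_add]
    have e4 : F f (a * q + j + 1) 0 = F f (a * q) (j + 1) := by
      rw [add_assoc, hshift f hf (j + 1) (a * q) 0 (by omega) (by omega), zero_add]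
    rw [e1, e2, e3, e4] at h1
    change mkPattern (F f ((a + 1 + i - i) * q) j) (F f ((a + 1 + i - (i + 1)) * q) j)
      (F f ((a + 1 + i - i) * q) (j + 1)) (F f ((a + 1 + i - (i + 1)) * q) (j + 1)) ∈ B
    rwa [show a + 1 + i - i = a + 1 by omega, show a + 1 + i - (i + 1) = a by omega]
  · intro f hf g hg hfg
    have hcol : ∀ a ≤ n, ∀ j ≤ q, F f (a * q) j = F g (a * q) j := by
      intro a ha j hj
      have := congrFun (congrFun hfg ⟨n - a, by omega⟩) ⟨j, by omega⟩
      simpa [show n - (n - a) = a by omega] using this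
    have hall : ∀ t ≤ n * q, ∀ j ≤ q, F f t j = F g t j := by
      intro t ht j hj
      have hdiv := Nat.div_add_mod' t q
      have hmod := Nat.mod_lt t hq
      set a := t / q
      set b := t % q
      have han : a ≤ n := Nat.div_le_of_le_mul (by rwa [mul_comm])
      rcases le_or_gt (b + j) q with hbj | hbj
      · rw [← hdiv, hshift f hf b _ _ (by omega) (by omega),
          hshift g hg b _ _ (by omega) (by omega)]
        exact hcol a han _ (by omega)
      · have hlt : a < n := by
          by_contra hcon
          have : n * q ≤ a * q := Nat.mul_le_mul_right q (by omega)
          omega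
        have hle : (a + 1) * q ≤ n * q := Nat.mul_le_mul_right q hlt
        have e : (a + 1) * q = t + (q - b) := by rw [add_mul, one_mul]; omega
        have h1 := hshift f hf (q - b) t (j - (q - b)) (by omega) (by omega)
        have h2 := hshift g hg (q - b) t (j - (q - b)) (by omega) (by omega)
        rw [show j - (q - b) + (q - b) = j by omega, ← e] at h1 h2
        rw [← h1, ← h2]
        exact hcol (a + 1) hlt _ (by omega)
    funext ⟨t, ht⟩ ⟨j, hj⟩
    rw [← hF f t j ht hj, ← hF g t j ht hj]
    exact hall t (by omega) j (by omega)

open Fin.CommRing in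
/-- Rows `u⁰, …, u^q` with `u^q = σ⁻¹ u⁰` extend to a pattern that is invariant under `(m, 0)` and
`(1, q)`. Its column `s (b + q a) = u^b (-a)` has period `m q` and determines the rows. -/
theorem T_pow_apply_le_trace_Tskew_pow (m q : ℕ) (hm : 1 ≤ m) (hq : 1 ≤ q) (u : Fin m → Fin r) :
    (T B m ^ q) u ((shift r m).symm u) ≤ (Tskew B q ^ (q * m)).trace := by
  obtain ⟨m, rfl⟩ : ∃ m', m = m' + 1 := ⟨m - 1, by omega⟩
  rw [T_eq_relMatrix, relMatrix_pow_apply, Tskew_eq_relMatrix, trace_relMatrix_pow, Nat.cast_le]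
  -- translation by `(1, q)` moves position `-a - 1` of row `b` to position `-a` of row `b + q`
  let x (a : ℕ) : Fin (m + 1) := -(a : Fin (m + 1))
  have hx : ∀ a, finRotate (m + 1) (x (a + 1)) = x a := by
    intro a
    rw [finRotate_apply]
    simp only [x]
    push_cast
    ring
  have hxm : ∀ a, x (a + (m + 1)) = x a := by
    intro a
    simp only [x]
    rw [Nat.cast_add, Fin.natCast_self, add_zero]
  let s (g : Fin (q + 1) → Fin (m + 1) → Fin r) (t : ℕ) : Fin r :=
    g (Fin.ofNat _ (t % q)) (x (t / q))
  have hs : ∀ g, g 0 = u → g (Fin.last q) = (shift r (m + 1)).symm u →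
      ∀ a b (hb : b < q + 1), s g (b + q * a) = g ⟨b, hb⟩ (x a) := by
    intro g h0 hl a b hb
    rcases (Nat.lt_succ_iff.1 hb).lt_or_eq with hlt | rfl
    · simp only [s]
      rw [Nat.add_mul_mod_self_left, Nat.mod_eq_of_lt hlt, Nat.add_mul_div_left _ _ hq,
        Nat.div_eq_of_lt hlt, zero_add]
      congr 1
      simp [Fin.ofNat, Nat.mod_eq_of_lt hb]
    · have e : b + b * a = b * (a + 1) := by ring
      have hl' : g ⟨b, hb⟩ = (shift r (m + 1)).symm u := hl
      simp only [s]
      rw [e, Nat.mul_mod_right, Nat.mul_div_cancel_left _ hq, hl']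
      change g 0 _ = u ((finRotate (m + 1)).symm (x a))
      rw [h0, ← hx a, Equiv.symm_apply_apply]
  refine Set.ncard_le_ncard_of_injOn
    (fun g (t : Fin (q * (m + 1) + 1)) (j : Fin (q + 1)) => s g (t + j)) ?_ ?_ (Set.toFinite _)
  · rintro g ⟨hg, h0, hl⟩
    refine ⟨fun t => ⟨fun i => ?_, ?_⟩, ?_⟩
    · simp only [Fin.val_succ, Fin.val_castSucc]
      congr 1
      ring
    · have hdiv := Nat.mod_add_div (t : ℕ) q
      have hmod := Nat.mod_lt (t : ℕ) hq
      set a := (t : ℕ) / q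
      set b := (t : ℕ) % q
      have key := hg ⟨b, hmod⟩ (x (a + 1))
      rw [hx] at key
      have e1 := hs g h0 hl a b (by omega)
      have e2 := hs g h0 hl a (b + 1) (by omega)
      have e3 := hs g h0 hl (a + 1) b (by omega)
      have e4 := hs g h0 hl (a + 1) (b + 1) (by omega)
      simp only [Fin.val_succ, Fin.val_castSucc, Fin.val_last, Fin.val_zero, add_zero]
      rw [mul_add, mul_one] at e3 e4
      rw [show (t : ℕ) + q = b + (q * a + q) by omega, show (t : ℕ) = b + q * a by omega,
        show b + q * a + 1 = b + 1 + q * a by omega,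
        show b + 1 + q * a + q = b + 1 + (q * a + q) by omega, e1, e2, e3, e4]
      exact key
    · funext j
      simp only [Fin.val_zero, Fin.val_last, zero_add, s]
      rw [Nat.mul_add_mod, Nat.mul_add_div hq, add_comm (m + 1), hxm]
  · rintro g ⟨-, hg0, hgl⟩ g' ⟨-, hg0', hgl'⟩ hgg
    funext b y
    induction b using Fin.lastCases with
    | last => rw [hgl, hgl']
    | cast b =>
      obtain ⟨a, ha, rfl⟩ : ∃ a < m + 1, x a = y := by
        refine ⟨(-y).val, (-y).isLt, ?_⟩
        simp only [x]
        rw [Fin.cast_val_eq_self, neg_neg]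
      have hlt : (b : ℕ) + q * a < q * (m + 1) + 1 := by
        have : q * (a + 1) ≤ q * (m + 1) := Nat.mul_le_mul_left q ha
        rw [mul_add, mul_one] at this
        omega
      have := congrFun (congrFun hgg ⟨b + q * a, hlt⟩) 0
      simp only [Fin.val_zero, add_zero] at this
      rw [hs g hg0 hgl a b (by omega), hs g' hg0' hgl' a b (by omega)] at this
      exact this

end Transfer

/-! ### Existence of the entropy -/

section Entropy

theorem log_le_coe_iff (x : ℝ≥0∞) (c : ℝ) :
    ENNReal.log x ≤ (c : EReal) ↔ x ≤ ENNReal.ofReal (Real.exp c) := by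
  have hc : (c : EReal) = ENNReal.log (ENNReal.ofReal (Real.exp c)) := by
    rw [ENNReal.log_ofReal_of_pos (Real.exp_pos c), Real.log_exp]
  rw [hc, ENNReal.log_le_log_iff]

theorem coe_le_log_iff (x : ℝ≥0∞) (c : ℝ) :
    (c : EReal) ≤ ENNReal.log x ↔ ENNReal.ofReal (Real.exp c) ≤ x := by
  have hc : (c : EReal) = ENNReal.log (ENNReal.ofReal (Real.exp c)) := by
    rw [ENNReal.log_ofReal_of_pos (Real.exp_pos c), Real.log_exp]
  rw [hc, ENNReal.log_le_log_iff]

variable {r : ℕ} (B : Set (Pattern r))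

theorem entropyRate_le_iff {n k : ℕ} (hn : 1 ≤ n) (hk : 1 ≤ k) (b : ℝ) :
    entropyRate B (n, k) ≤ b ↔ ((admissible B n k).ncard : ℝ) ≤ Real.exp (b * (n * k)) := by
  have hnk : 0 < n * k := Nat.mul_pos hn hk
  have e : ((n * k : ℕ) : EReal) * (b : EReal) = ((b * (n * k) : ℝ) : EReal) := by
    rw [← EReal.coe_coe_eq_natCast, ← EReal.coe_mul, EReal.coe_eq_coe_iff]
    push_cast
    ring
  rw [entropyRate, EReal.div_le_iff_le_mul (by exact_mod_cast hnk) (EReal.natCast_ne_top _), e,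
    log_le_coe_iff, ← ENNReal.ofReal_natCast,
    ENNReal.ofReal_le_ofReal_iff (Real.exp_pos _).le]

theorem le_entropyRate_iff {n k : ℕ} (hn : 1 ≤ n) (hk : 1 ≤ k) (b : ℝ) :
    b ≤ entropyRate B (n, k) ↔ Real.exp (b * (n * k)) ≤ ((admissible B n k).ncard : ℝ) := by
  have hnk : 0 < n * k := Nat.mul_pos hn hk
  have e : (b : EReal) * ((n * k : ℕ) : EReal) = ((b * (n * k) : ℝ) : EReal) := by
    rw [← EReal.coe_coe_eq_natCast, ← EReal.coe_mul, EReal.coe_eq_coe_iff]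
    push_cast
    ring
  rw [entropyRate, EReal.le_div_iff_mul_le (by exact_mod_cast hnk) (EReal.natCast_ne_top _), e,
    coe_le_log_iff, ← ENNReal.ofReal_natCast,
    ENNReal.ofReal_le_ofReal_iff (Nat.cast_nonneg _)]

theorem ncard_admissible_le (n k : ℕ) : (admissible B n k).ncard ≤ r ^ (n * k) := by
  refine (Set.ncard_le_card _).trans_eq ?_
  simp [← pow_mul, mul_comm]

theorem ncard_admissible_add_left_le (n n' k : ℕ) :
    (admissible B (n + n') k).ncard ≤ (admissible B n k).ncard * (admissible B n' k).ncard := by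
  rw [← Set.ncard_prod]
  refine Set.ncard_le_ncard_of_injOn
    (fun U => (fun i => U (Fin.castAdd n' i), fun i => U (Fin.natAdd n i))) ?_ ?_ (Set.toFinite _)
  · intro U hU
    exact ⟨fun i j hi hj => hU i j (by omega) hj,
      fun i j hi hj => hU (n + i) j (by omega) hj⟩
  · intro U _ V _ h
    rw [Prod.mk.injEq] at h
    funext i
    induction i using Fin.addCases with
    | left i => exact congrFun h.1 i
    | right i => exact congrFun h.2 i

theorem ncard_admissible_add_right_le (n k k' : ℕ) :
    (admissible B n (k + k')).ncard ≤ (admissible B n k).ncard * (admissible B n k').ncard := by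
  rw [← Set.ncard_prod]
  refine Set.ncard_le_ncard_of_injOn
    (fun U => (fun i j => U i (Fin.castAdd k' j), fun i j => U i (Fin.natAdd k j))) ?_ ?_
    (Set.toFinite _)
  · intro U hU
    exact ⟨fun i j hi hj => hU i j hi (by omega),
      fun i j hi hj => hU i (k + j) hi (by omega)⟩
  · intro U _ V _ h
    rw [Prod.mk.injEq] at h
    funext i j
    induction j using Fin.addCases with
    | left j => exact congrFun (congrFun h.1 i) j
    | right j => exact congrFun (congrFun h.2 i) j

theorem ncard_admissible_mul_add_left_le (p a c k : ℕ) :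
    (admissible B (p * a + c) k).ncard ≤
      (admissible B p k).ncard ^ a * (admissible B c k).ncard := by
  induction a with
  | zero => rw [mul_zero, zero_add, pow_zero, one_mul]
  | succ a ih =>
    rw [show p * (a + 1) + c = p + (p * a + c) by ring, pow_succ', mul_assoc]
    exact (ncard_admissible_add_left_le B _ _ _).trans (Nat.mul_le_mul_left _ ih)

theorem ncard_admissible_mul_add_right_le (n q d e : ℕ) :
    (admissible B n (q * d + e)).ncard ≤
      (admissible B n q).ncard ^ d * (admissible B n e).ncard := by
  induction d with
  | zero => rw [mul_zero, zero_add, pow_zero, one_mul]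
  | succ d ih =>
    rw [show q * (d + 1) + e = q + (q * d + e) by ring, pow_succ', mul_assoc]
    exact (ncard_admissible_add_right_le B _ _ _).trans (Nat.mul_le_mul_left _ ih)

/-- A large rectangle is tiled by `p × q` rectangles, up to a part of size `q n + p k`. -/
theorem ncard_admissible_le_pow_mul_pow (hr : 1 ≤ r) {p q : ℕ} (hp : 1 ≤ p) (hq : 1 ≤ q)
    (n k : ℕ) : (admissible B n k).ncard ≤
      (admissible B p q).ncard ^ (k / q * (n / p)) * r ^ (q * n + p * k) := by
  have h1 := ncard_admissible_mul_add_left_le B p (n / p) (n % p) k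
  have h2 := ncard_admissible_mul_add_right_le B p q (k / q) (k % q)
  rw [Nat.div_add_mod] at h1 h2
  have h3 : p * (k % q) * (n / p) ≤ q * n := by
    calc p * (k % q) * (n / p) = k % q * (p * (n / p)) := by ring
      _ ≤ q * n := Nat.mul_le_mul (Nat.mod_lt k hq).le (Nat.mul_div_le n p)
  have h4 : n % p * k ≤ p * k := Nat.mul_le_mul_right k (Nat.mod_lt n hp).le
  calc (admissible B n k).ncard
      ≤ ((admissible B p q).ncard ^ (k / q) * r ^ (p * (k % q))) ^ (n / p) * r ^ (n % p * k) :=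
        h1.trans (Nat.mul_le_mul (Nat.pow_le_pow_left
          (h2.trans (Nat.mul_le_mul_left _ (ncard_admissible_le B _ _))) _)
          (ncard_admissible_le B _ _))
    _ = (admissible B p q).ncard ^ (k / q * (n / p)) *
          r ^ (p * (k % q) * (n / p) + n % p * k) := by
        rw [mul_pow, ← pow_mul, ← pow_mul, pow_add, mul_assoc]
    _ ≤ _ := Nat.mul_le_mul_left _ (Nat.pow_le_pow_right hr (by omega))

theorem eventually_entropyRate_le (hr : 1 ≤ r) {p q : ℕ} (hp : 1 ≤ p) (hq : 1 ≤ q) {b b' : ℝ}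
    (hbb : b < b') (h : entropyRate B (p, q) ≤ b) :
    ∀ᶠ x in atTop, entropyRate B x ≤ b' := by
  rw [entropyRate_le_iff B hp hq] at h
  obtain ⟨M, hM⟩ := exists_nat_ge (2 * Real.log r / (b' - b))
  rw [div_le_iff₀ (sub_pos.2 hbb)] at hM
  filter_upwards [eventually_ge_atTop (p * (M + 1), q * (M + 1))]
  rintro ⟨n, k⟩ hnk
  obtain ⟨hn, hk⟩ : p * (M + 1) ≤ n ∧ q * (M + 1) ≤ k := hnk
  have hpn : p ≤ n := (Nat.le_mul_of_pos_right p M.succ_pos).trans hn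
  have hqk : q ≤ k := (Nat.le_mul_of_pos_right q M.succ_pos).trans hk
  rw [entropyRate_le_iff B (hp.trans hpn) (hq.trans hqk)]
  have hmain := ncard_admissible_le_pow_mul_pow B hr hp hq n k
  have hdn : 1 ≤ n / p := Nat.div_pos hpn hp
  have hdk : 1 ≤ k / q := Nat.div_pos hqk hq
  rcases lt_or_ge b 0 with hb | hb
  · -- a negative rate means that there is no admissible `p × q` pattern
    have h0 : (admissible B p q).ncard = 0 := by
      have : ((admissible B p q).ncard : ℝ) < 1 :=
        h.trans_lt (Real.exp_lt_one_iff.2 (mul_neg_of_neg_of_pos hb (by positivity)))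
      exact_mod_cast Nat.lt_one_iff.1 (by exact_mod_cast this)
    rw [h0, zero_pow (by positivity), zero_mul, Nat.le_zero] at hmain
    rw [hmain, Nat.cast_zero]
    exact (Real.exp_pos _).le
  have hr0 : (0 : ℝ) < r := by exact_mod_cast hr
  have hlog : 0 ≤ Real.log r := Real.log_nonneg (by exact_mod_cast hr)
  have hN : ((admissible B n k).ncard : ℝ) ≤
      Real.exp (b * (p * q)) ^ (k / q * (n / p)) * Real.exp (Real.log r) ^ (q * n + p * k) := by
    rw [Real.exp_log hr0]
    calc ((admissible B n k).ncard : ℝ)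
        ≤ ((admissible B p q).ncard : ℝ) ^ (k / q * (n / p)) * (r : ℝ) ^ (q * n + p * k) := by
          exact_mod_cast hmain
      _ ≤ _ := by gcongr
  refine hN.trans ?_
  rw [← Real.exp_nat_mul, ← Real.exp_nat_mul, ← Real.exp_add, Real.exp_le_exp]
  push_cast
  have h1 : (p : ℝ) * (n / p : ℕ) ≤ n := by exact_mod_cast Nat.mul_div_le n p
  have h2 : (q : ℝ) * (k / q : ℕ) ≤ k := by exact_mod_cast Nat.mul_div_le k q
  have h3 : ((k / q : ℕ) : ℝ) * (n / p : ℕ) * (b * (p * q)) ≤ b * (n * k) := by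
    calc ((k / q : ℕ) : ℝ) * (n / p : ℕ) * (b * (p * q))
        = b * ((p * (n / p : ℕ)) * (q * (k / q : ℕ))) := by ring
      _ ≤ _ := by gcongr
  have hn' : (p : ℝ) * M ≤ n := by exact_mod_cast (Nat.mul_le_mul_left p M.le_succ).trans hn
  have hk' : (q : ℝ) * M ≤ k := by exact_mod_cast (Nat.mul_le_mul_left q M.le_succ).trans hk
  have hd : 0 ≤ b' - b := (sub_pos.2 hbb).le
  have h4 : 2 * (q * n * Real.log r) ≤ (b' - b) * (n * k) := by
    calc 2 * (q * n * Real.log r) = q * n * (2 * Real.log r) := by ring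
      _ ≤ q * n * (M * (b' - b)) := by gcongr
      _ = (b' - b) * n * (q * M) := by ring
      _ ≤ (b' - b) * n * k := by gcongr
      _ = _ := by ring
  have h5 : 2 * (p * k * Real.log r) ≤ (b' - b) * (n * k) := by
    calc 2 * (p * k * Real.log r) = p * k * (2 * Real.log r) := by ring
      _ ≤ p * k * (M * (b' - b)) := by gcongr
      _ = (b' - b) * k * (p * M) := by ring
      _ ≤ (b' - b) * k * n := by gcongr
      _ = _ := by ring
  linarith

/-- The two-dimensional form of Fekete's lemma, for the number of admissible patterns. -/
theorem tendsto_entropyRate (hr : 1 ≤ r) :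
    Tendsto (entropyRate B) atTop (𝓝 (spatialEntropy B)) := by
  refine tendsto_of_le_liminf_of_limsup_le ?_ le_rfl
  by_contra! hlt
  obtain ⟨b', hb', hb'lt⟩ := EReal.lt_iff_exists_real_btwn.1 hlt
  obtain ⟨b, hb, hblt⟩ := EReal.lt_iff_exists_real_btwn.1 hb'
  have hfreq := (frequently_lt_of_liminf_lt (by isBoundedDefault) hb).and_eventually
    (eventually_ge_atTop (1, 1))
  obtain ⟨⟨p, q⟩, hpq, hge⟩ := hfreq.exists
  have hev := eventually_entropyRate_le B hr hge.1 hge.2 (EReal.coe_lt_coe_iff.1 hblt) hpq.le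
  exact (limsup_le_of_le (by isBoundedDefault) hev).not_gt hb'lt

end Entropy

/-! ### Comparison of the entropy with the skew transition matrices -/

section Bounds

variable {r : ℕ} {B : Set (Pattern r)}

theorem limsup_log_rho_Tskew_le (hr : 1 ≤ r) :
    limsup (fun q : ℕ => ENNReal.log (rho (Tskew B q))) atTop ≤ spatialEntropy B := by
  refine EReal.le_of_forall_lt_iff_le.1 fun b hb => ?_
  obtain ⟨c, hc, hcb⟩ := EReal.lt_iff_exists_real_btwn.1 hb
  rw [EReal.coe_lt_coe_iff] at hcb
  obtain ⟨⟨M, N⟩, hMN⟩ := eventually_atTop.1 ((tendsto_entropyRate B hr).eventually_lt_const hc)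
  obtain ⟨L, hL⟩ := exists_nat_ge (c / (b - c))
  rw [div_le_iff₀ (sub_pos.2 hcb)] at hL
  refine limsup_le_of_le (by isBoundedDefault) ?_
  filter_upwards [eventually_ge_atTop (N + L + 1)] with q hq
  have hq0 : (0 : ℝ) < q := by exact_mod_cast (by omega : 0 < q)
  have hrho : rho (Tskew B q) ≤ ENNReal.ofReal (Real.exp (c * (q + 1) / q)) := by
    have hnn : ∀ i j, 0 ≤ Tskew B q i j := by
      rw [Tskew_eq_relMatrix]
      exact relMatrix_nonneg _
    refine rho_le_of_frequently hnn (Real.exp_pos _).le (Real.exp_pos (c * (q + 1))) ?_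
    rw [frequently_atTop]
    intro K
    refine ⟨(M + K) * q, by nlinarith, (entrySum_Tskew_pow_le B (M + K) q (by omega)).trans ?_⟩
    have := (hMN (M + K + 1, q + 1) ⟨by simp only; omega, by simp only; omega⟩).le
    rw [entropyRate_le_iff B (by omega) (by omega)] at this
    refine this.trans_eq ?_
    rw [← Real.exp_nat_mul, ← Real.exp_add]
    congr 1
    push_cast
    field_simp
    ring
  refine ((log_le_coe_iff _ _).2 hrho).trans (EReal.coe_le_coe_iff.2 ?_)
  rw [div_le_iff₀ hq0]
  have : (L : ℝ) * (b - c) ≤ q * (b - c) :=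
    mul_le_mul_of_nonneg_right (by exact_mod_cast (by omega : L ≤ q)) (sub_pos.2 hcb).le
  linarith

/-- The horizontal transfer matrix of columns of height `k + 1` has spectral radius about
`exp ((k + 1) h)`, and its closed walks of length `m` are the patterns counted by `T_m ^ k`. -/
theorem frequently_exp_pow_le_entrySum_T_pow (hr : 1 ≤ r) {a b : ℝ} (hab : a < b)
    (hb : (b : EReal) < spatialEntropy B) :
    ∀ᶠ k : ℕ in atTop, ∃ C > 0, ∃ᶠ m : ℕ in atTop,
      C * Real.exp (a * (k + 1)) ^ m ≤ entrySum (T B m ^ k) := by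
  obtain ⟨⟨M, N⟩, hMN⟩ := eventually_atTop.1 ((tendsto_entropyRate B hr).eventually_const_lt hb)
  filter_upwards [eventually_ge_atTop N] with k hk
  have hnn := relMatrix_nonneg (colRel B k)
  have hrho : ENNReal.ofReal (Real.exp (b * (k + 1))) ≤ rho (relMatrix (colRel B k)) := by
    refine le_rho_of_frequently hnn (Real.exp_pos _).le (Real.exp_pos (b * (k + 1))) ?_
    refine ((eventually_ge_atTop M).mono fun n hn => ?_).frequently
    have := (hMN (n + 1, k + 1) ⟨by simp only; omega, by simp only; omega⟩).le
    rw [le_entropyRate_iff B (by omega) (by omega), admissible_succ_succ] at this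
    rw [entrySum_relMatrix_pow]
    refine le_trans (le_of_eq ?_) this
    rw [← Real.exp_nat_mul, ← Real.exp_add]
    congr 1
    push_cast
    ring
  have hlt : ENNReal.ofReal (Real.exp (a * (k + 1))) < rho (relMatrix (colRel B k)) := by
    refine lt_of_lt_of_le ((ENNReal.ofReal_lt_ofReal_iff (Real.exp_pos _)).2 ?_) hrho
    rw [Real.exp_lt_exp]
    exact mul_lt_mul_of_pos_right hab (by positivity)
  obtain ⟨c, C, hC, hfreq⟩ := exists_frequently_le_pow_apply_self hnn (Real.exp_pos _) hlt
  refine ⟨C, hC, (hfreq.and_eventually (eventually_ge_atTop 1)).mono fun m hm => ?_⟩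
  exact hm.1.trans (relMatrix_colRel_pow_apply_self_le B k m hm.2 c)

/-- For infinitely many `m`, `log ρ(T_m) / m` exceeds a given number below the entropy. -/
theorem frequently_exp_mul_le_rho_T (hr : 1 ≤ r)
    (hdom : UniformlyDominated (fun m k => entrySum (T B m ^ k))
      (fun m k => (rho (T B m)).toReal ^ k))
    {a : ℝ} (ha : (a : EReal) < spatialEntropy B) :
    ∃ᶠ m : ℕ in atTop, Real.exp (a * m) ≤ (rho (T B m)).toReal := by
  obtain ⟨b, hb, hbh⟩ := EReal.lt_iff_exists_real_btwn.1 ha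
  rw [EReal.coe_lt_coe_iff] at hb
  -- the gap `b - a` absorbs four errors: the passage from `b` to `b - ε`, the factor `c m k`, the
  -- height `k + 1` in place of `k` (as `k ≥ L`), and the constant `C` (as `m ≥ K`)
  set ε := (b - a) / 4 with hε
  have hεpos : 0 < ε := by rw [hε]; linarith
  obtain ⟨c, hc, hlim⟩ := hdom
  obtain ⟨⟨M, N⟩, hMN⟩ := eventually_atTop.1 (hlim.eventually_lt_const hεpos)
  obtain ⟨L, hL⟩ := exists_nat_ge (|b - ε| / ε)
  rw [div_le_iff₀ hεpos] at hL
  obtain ⟨k, ⟨C, hC, hfreq⟩, hk⟩ :=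
    ((frequently_exp_pow_le_entrySum_T_pow hr (by linarith : b - ε < b) hbh).and
      (eventually_ge_atTop (N + L + 1))).exists
  obtain ⟨K, hK⟩ := exists_nat_ge (-Real.log C / ε)
  rw [div_le_iff₀ hεpos] at hK
  refine (hfreq.and_eventually (eventually_ge_atTop (M + K + 1))).mono ?_
  rintro m ⟨hm, hmge⟩
  have hk1 : (1 : ℝ) ≤ k := by exact_mod_cast (by omega : 1 ≤ k)
  have hm1 : (1 : ℝ) ≤ m := by exact_mod_cast (by omega : 1 ≤ m)
  obtain ⟨hcpos, hcle⟩ := hc m k (by omega) (by omega)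
  have hclog : c m k ≤ Real.exp (ε * (m * k)) := by
    have := (hMN (m, k) ⟨by simp only; omega, by simp only; omega⟩).le
    rw [div_le_iff₀ (by positivity)] at this
    exact (Real.log_le_iff_le_exp hcpos).1 this
  have hρ : 0 ≤ (rho (T B m)).toReal := ENNReal.toReal_nonneg
  have h1 : C * Real.exp ((b - ε) * (k + 1)) ^ m ≤
      Real.exp (ε * (m * k)) * (rho (T B m)).toReal ^ k :=
    hm.trans (hcle.trans (mul_le_mul_of_nonneg_right hclog (pow_nonneg hρ k)))
  refine le_of_pow_le_pow_left₀ (by omega : k ≠ 0) hρ ?_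
  refine le_of_mul_le_mul_left (le_trans ?_ h1) (Real.exp_pos (ε * (m * k)))
  nth_rewrite 1 [← Real.exp_log hC]
  rw [← Real.exp_nat_mul, ← Real.exp_nat_mul, ← Real.exp_add, ← Real.exp_add, Real.exp_le_exp]
  have hb4 : b = a + 4 * ε := by rw [hε]; ring
  have h2 : -Real.log C ≤ ε * (m * k) := by
    have h3 : (K : ℝ) * ε ≤ m * ε :=
      mul_le_mul_of_nonneg_right (by exact_mod_cast (by omega : K ≤ m)) hεpos.le
    have h4 : (m : ℝ) * ε * 1 ≤ m * ε * k := mul_le_mul_of_nonneg_left hk1 (by positivity)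
    linarith
  have h5 : -((b - ε) * m) ≤ ε * (m * k) := by
    have h3 : (L : ℝ) * ε ≤ k * ε :=
      mul_le_mul_of_nonneg_right (by exact_mod_cast (by omega : L ≤ k)) hεpos.le
    have h4 : -(b - ε) ≤ k * ε := (neg_le_abs _).trans (hL.trans h3)
    nlinarith
  have h6 : (m : ℝ) * ((b - ε) * (k + 1)) = (b - ε) * m + (a + 3 * ε) * (m * k) := by
    rw [hb4]; ring
  linarith [mul_nonneg hεpos.le (by positivity : (0 : ℝ) ≤ m * k)]

theorem exists_trace_le_card_mul {n : Type*} [Fintype n] [Nonempty n] (A : Matrix n n ℝ) :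
    ∃ w, A.trace ≤ Fintype.card n * A w w := by
  obtain ⟨w, -, hw⟩ := Finset.exists_max_image Finset.univ (fun w => A w w) Finset.univ_nonempty
  refine ⟨w, (Finset.sum_le_card_nsmul _ _ (A w w) fun v hv => hw v hv).trans_eq ?_⟩
  rw [Finset.card_univ, nsmul_eq_mul]

/-- The lower bound, from two properties of the matrices `T_m`: their powers are dominated by
those of the spectral radius, and some entry in a position `(u, σ⁻¹ u)` grows at that rate. -/
theorem spatialEntropy_le_limsup_log_rho_Tskew (hr : 1 ≤ r)
    (hdom : UniformlyDominated (fun m k => entrySum (T B m ^ k))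
      (fun m k => (rho (T B m)).toReal ^ k))
    (hgrow : ∀ m, 1 ≤ m → ∃ u : Fin m → Fin r, ∀ a : ℝ, 0 < a → ENNReal.ofReal a < rho (T B m) →
      ∃ C > 0, ∃ᶠ q in atTop, C * a ^ q ≤ (T B m ^ q) u ((shift r m).symm u)) :
    spatialEntropy B ≤ limsup (fun q : ℕ => ENNReal.log (rho (Tskew B q))) atTop := by
  refine EReal.ge_of_forall_gt_iff_ge.1 fun a ha => ?_
  obtain ⟨c, hac, hc⟩ := EReal.lt_iff_exists_real_btwn.1 ha
  obtain ⟨b, hab, hbc⟩ := EReal.lt_iff_exists_real_btwn.1 hac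
  rw [EReal.coe_lt_coe_iff] at hab hbc
  have hd : 0 < b - a := sub_pos.2 hab
  -- for `m ≥ M` the gain `q m (b - a)` exceeds `q log r`, the logarithm of the number of windows
  -- up to a constant, by at least `q`
  obtain ⟨M, hM⟩ := exists_nat_ge ((Real.log r + 1) / (b - a))
  rw [div_le_iff₀ hd] at hM
  obtain ⟨m, hm, hmM⟩ := ((frequently_exp_mul_le_rho_T hr hdom hc).and_eventually
    (eventually_ge_atTop (M + 1))).exists
  have hm0 : (0 : ℝ) < m := by exact_mod_cast (by omega : 0 < m)
  have hlt : ENNReal.ofReal (Real.exp (b * m)) < rho (T B m) := by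
    rw [← ENNReal.ofReal_toReal (rho_ne_top (T B m))]
    refine (ENNReal.ofReal_lt_ofReal_iff ((Real.exp_pos _).trans_le hm)).2 (lt_of_lt_of_le ?_ hm)
    rw [Real.exp_lt_exp]
    exact mul_lt_mul_of_pos_right hbc hm0
  obtain ⟨u, hu⟩ := hgrow m (by omega)
  obtain ⟨C, hC, hfreq⟩ := hu _ (Real.exp_pos _) hlt
  obtain ⟨Q, hQ⟩ := exists_nat_ge (Real.log r - Real.log C)
  refine le_limsup_of_frequently_le
    ((hfreq.and_eventually (eventually_ge_atTop (Q + 1))).mono ?_) (by isBoundedDefault)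
  rintro q ⟨hq, hqQ⟩
  rw [coe_le_log_iff]
  have : NeZero r := ⟨by omega⟩
  obtain ⟨w, hw⟩ := exists_trace_le_card_mul (Tskew B q ^ (q * m))
  have hnn : ∀ i j, 0 ≤ Tskew B q i j := by
    rw [Tskew_eq_relMatrix]
    exact relMatrix_nonneg _
  refine le_rho_of_pow_le_apply_self hnn (u := w) (Real.exp_pos a).le
    (Nat.mul_pos (by omega : 0 < q) (by omega : 0 < m)) ?_
  have hr0 : (0 : ℝ) < r := by exact_mod_cast hr
  have hcard : (Fintype.card (Fin (q + 1) → Fin r) : ℝ) = Real.exp (Real.log r) ^ (q + 1) := by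
    rw [Real.exp_log hr0]
    simp
  rw [hcard] at hw
  have hle := hq.trans ((T_pow_apply_le_trace_Tskew_pow B m q (by omega) (by omega) u).trans hw)
  refine le_of_mul_le_mul_left (le_trans ?_ hle) (pow_pos (Real.exp_pos (Real.log r)) (q + 1))
  nth_rewrite 1 [← Real.exp_log hC]
  rw [← Real.exp_nat_mul, ← Real.exp_nat_mul, ← Real.exp_nat_mul, ← Real.exp_add, ← Real.exp_add,
    Real.exp_le_exp]
  push_cast
  have h1 : (Q : ℝ) ≤ q := by exact_mod_cast (by omega : Q ≤ q)
  have h2 : (M : ℝ) ≤ m := by exact_mod_cast (by omega : M ≤ m)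
  have h3 : Real.log r + 1 ≤ m * (b - a) := hM.trans (mul_le_mul_of_nonneg_right h2 hd.le)
  have h4 : (q : ℝ) * (Real.log r + 1) ≤ q * (m * (b - a)) :=
    mul_le_mul_of_nonneg_left h3 (Nat.cast_nonneg q)
  nlinarith

theorem UniformlyDominated.trans {N D E : ℕ → ℕ → ℝ} (h₁ : UniformlyDominated N D)
    (h₂ : UniformlyDominated D E) : UniformlyDominated N E := by
  obtain ⟨c, hc, hlimc⟩ := h₁
  obtain ⟨d, hd, hlimd⟩ := h₂
  refine ⟨fun m k => c m k * d m k, fun m k hm hk =>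
    ⟨mul_pos (hc m k hm hk).1 (hd m k hm hk).1, ?_⟩, ?_⟩
  · rw [mul_assoc]
    exact (hc m k hm hk).2.trans
      (mul_le_mul_of_nonneg_left (hd m k hm hk).2 (hc m k hm hk).1.le)
  · have := hlimc.add hlimd
    rw [add_zero] at this
    refine this.congr' ?_
    filter_upwards [eventually_ge_atTop (1, 1)] with p hp
    rw [Real.log_mul (hc _ _ hp.1 hp.2).1.ne' (hd _ _ hp.1 hp.2).1.ne', add_div]

end Bounds
end SkewEntropy

open SkewEntropy in
theorem theorem1p6 (r : ℕ) (hr : 2 ≤ r) (B : Set (Pattern r))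
    (hB :
      -- every `T_m(B)` is irreducible, and the sequence is dominated by the spectral radii
      ((∀ m : ℕ, 1 ≤ m → (T B m).IsIrreducible) ∧
        UniformlyDominated
          (fun m k => entrySum (T B m ^ k))
          (fun m k => (rho (T B m)).toReal ^ k)) ∨
      -- or there are maximum irreducible submatrices with the analogous properties
      (∃ I : (m : ℕ) → Finset (Fin m → Fin r),
        (∀ m : ℕ, 1 ≤ m →
          IsMaxIrreducible (T B m) (I m) ∧
          ∃ u : Fin m → Fin r, u ∈ I m ∧ (shift r m).symm u ∈ I m) ∧
        UniformlyDominated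
          (fun m k => entrySum (T B m ^ k))
          (fun m k => entrySum (principal (T B m) (I m) ^ k)) ∧
        UniformlyDominated
          (fun m k => entrySum (principal (T B m) (I m) ^ k))
          (fun m k => (rho (T B m)).toReal ^ k))) :
    Tendsto (entropyRate B) atTop (𝓝 (spatialEntropy B)) ∧
      spatialEntropy B = limsup (fun q : ℕ => ENNReal.log (rho (Tskew B q))) atTop := by
  have hr1 : 1 ≤ r := by omega
  refine ⟨tendsto_entropyRate B hr1, le_antisymm ?_ (limsup_log_rho_Tskew_le hr1)⟩
  rcases hB with ⟨hirr, hdom⟩ | ⟨I, hI, hdom₁, hdom₂⟩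
  · refine spatialEntropy_le_limsup_log_rho_Tskew hr1 hdom fun m hm =>
      ⟨fun _ => ⟨0, hr1⟩, fun a ha hlt => ?_⟩
    exact exists_frequently_le_pow_apply (hirr m hm) _ _ ha hlt
  · refine spatialEntropy_le_limsup_log_rho_Tskew hr1 (hdom₁.trans hdom₂) fun m hm => ?_
    obtain ⟨⟨hirr, hrho⟩, u, hu, hu'⟩ := hI m hm
    refine ⟨u, fun a ha hlt => ?_⟩
    rw [← hrho] at hlt
    obtain ⟨C, hC, hfreq⟩ := exists_frequently_le_pow_apply hirr ⟨u, hu⟩ ⟨_, hu'⟩ ha hlt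
    have hnn : ∀ i j, 0 ≤ T B m i j := by
      rw [T_eq_relMatrix]
      exact relMatrix_nonneg _
    exact ⟨C, hC, hfreq.mono fun q hq =>
      hq.trans (submatrix_pow_apply_le hnn Subtype.val_injective q _ _)⟩
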